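/- Let $(F,d)$ be a non-empty totally bounded metric space. A set $A\subseteq F$ is $r$-separated if $d(x,y)\ge r$ for all distinct $x,y\in A$. A choice of abstract rationals for $F$ is a family $(P(q))_{q\ge 1}$ in which $P(q)$ is, for every integer $q\ge 1$, a maximal (with respect to inclusion) $(1/q)$-separated subset of $F$. Given such a choice, for $t>0$ put $$F_t=\bigcap_{N}\ \bigcup_{q>N}\ \bigcup_{p\in P(q)}\{x\in F: d(p,x)\le q^{-t}\}.$$ Let $\dim_{\mathrm H}$ denote Hausdorff dimension, and let $\dim_{\mathrm P}$ denote packing dimension, $$\dim_{\mathrm P}X=\inf\Big\{\sup_{i}\overline{\dim}_{\mathrm B}X_i : X=\bigcup_{i\in\mathbb N}X_i\Big\},\qquad \overline{\dim}_{\mathrm B}X=\limsup_{r\to0}\frac{\log N_r(X)}{-\log r},$$ where $N_r(X)$ is the maximal cardinality of an $r$-separated subset of $X$. Proposition. There exists a compact set $F\subseteq[0,1]$ with $\dim_{\mathrm H}F=\dim_{\mathrm P}F>0$ such that, for some choice of abstract rationals, $F_t$ is countable for all $t>1$ and, for another choice of abstract rationals, $\dim_{\mathrm H}F_t>0$ for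 all $t>1$. Moreover, one may take $F$ to be the union of the middle-third Cantor set and the set of midpoints of its (bounded) complementary intervals. -/

import Mathlib

open Set Filter Topology
open scoped ENNReal

noncomputable section

/-- `A` is `r`-separated: distinct points of `A` are at distance at least `r`. -/
def IsRSeparated {X : Type*} [MetricSpace X] (r : ℝ) (A : Set X) : Prop :=
  A.Pairwise fun x y => r ≤ dist x y

/-- A choice of abstract rationals for `F`: for each level `q ≥ 1`, the set `P q` is a maximal
`(1/q)`-separated subset of `F`. -/
def IsAbstractRationals {X : Type*} [MetricSpace X] (F : Set X) (P : ℕ → Set X) : Prop :=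
  ∀ q : ℕ, 1 ≤ q → Maximal (fun S : Set X => S ⊆ F ∧ IsRSeparated (1 / (q : ℝ)) S) (P q)

/-- The set `F_t` of points of `F` that lie, for infinitely many `q`, in a closed ball of radius
`1/q^t` about some point of `P q`. -/
def approximableSet {X : Type*} [MetricSpace X] (F : Set X) (P : ℕ → Set X) (t : ℝ) : Set X :=
  {x ∈ F | ∀ N : ℕ, ∃ q : ℕ, N < q ∧ ∃ p ∈ P q, dist p x ≤ 1 / (q : ℝ) ^ t}

/-- `N_r(A)`: the largest cardinality of an `r`-separated subset of `A`, possibly `∞`. -/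
def separationNumber {X : Type*} [MetricSpace X] (r : ℝ) (A : Set X) : ℕ∞ :=
  ⨆ (S : Set X) (_ : S ⊆ A ∧ IsRSeparated r S), S.encard

/-- The upper box dimension `limsup_{r → 0} log N_r(A) / (-log r)`. The logarithm takes the values
`log 0 = -∞` and `log ∞ = ∞`; the empty set is given dimension `0`. -/
def upperBoxDim {X : Type*} [MetricSpace X] (A : Set X) : ℝ≥0∞ :=
  (limsup (fun r : ℝ => ENNReal.log (separationNumber r A : ℝ≥0∞) / ((-Real.log r : ℝ) : EReal))
    (𝓝[>] (0 : ℝ))).toENNReal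

/-- The packing dimension: the infimum, over all countable decompositions `A = ⋃ i, A i`, of the
supremum of the upper box dimensions of the pieces. -/
def packingDim {X : Type*} [MetricSpace X] (A : Set X) : ℝ≥0∞ :=
  ⨅ (B : ℕ → Set X) (_ : A = ⋃ i, B i), ⨆ i, upperBoxDim (B i)

/-- The midpoints of the bounded complementary intervals (gaps) of a closed set `K ⊆ ℝ`. -/
def gapMidpoints (K : Set ℝ) : Set ℝ :=
  {m | ∃ a ∈ K, ∃ b ∈ K, a < b ∧ Disjoint (Ioo a b) K ∧ m = (a + b) / 2}

end

/-! ### Separation numbers, box dimension and packing dimension. -/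

section BoxDimension

variable {X : Type*} [MetricSpace X]

/-! Let `C` be the Cantor set and `F` its union with the gap midpoints. The midpoints form a
countable set, so they change neither dimension: the chain `dimH F ≤ packingDim F ≤ upperBoxDim C ≤
log 2 / log 3 ≤ dimH C ≤ dimH F` closes up.

The freedom in choosing maximal separated sets does the rest. One can build each `P q` from
midpoints only, all at distance at least `1 / (12 q)` from `C`
(`exists_isSeparatedNet_far_from_cantorSet`). For `t > 1` the radius `q ^ (-t)` is eventually
smaller than that, so `F_t` contains no point of `C` and is countable.

Alternatively, at the levels `q = 2 * 3 ^ n` one can let `P q` contain every Cantor point whose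
ternary digits vanish after position `n`. A Cantor point with zero digits from position `n + 1` up
to `T * (n + 1) - 1` is then within `3 ^ (-T * (n + 1)) ≤ q ^ (-t)` of `P q` whenever `t ≤ T`.
Requiring such zero blocks at geometrically growing places leaves a positive proportion of digits
free, hence a subset of `F_t` of positive dimension (`le_dimH_range_cantorPoint_spreadDigits`).

Both families of nets come from the self-similarity of `F`: `trisect` turns a net at scale `r ≤ 1/2`
into one at scale `r / 3`. -/

theorem exists_finset_cover_of_separationNumber_lt_top {A : Set X} {r : ℝ} (hr : 0 < r)
    (h : separationNumber r A < ⊤) :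
    ∃ S : Finset X, A ⊆ ⋃ s : S, Metric.closedBall (s : X) r ∧
      (S.card : ℕ∞) ≤ separationNumber r A := by
  classical
  obtain ⟨S, hS, hmax⟩ : ∃ S : Set X, (S ⊆ A ∧ IsRSeparated r S) ∧
      S.encard = separationNumber r A := by
    have hne : Nonempty {S : Set X // S ⊆ A ∧ IsRSeparated r S} :=
      ⟨⟨∅, empty_subset _, by simp [IsRSeparated]⟩⟩
    have e : separationNumber r A =
        ⨆ S : {S : Set X // S ⊆ A ∧ IsRSeparated r S}, S.1.encard := by
      rw [separationNumber, iSup_subtype]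
    rw [e] at h ⊢
    obtain ⟨S, hS⟩ := ENat.exists_eq_iSup_of_lt_top h
    exact ⟨S.1, S.2, hS⟩
  have hfin : S.Finite := by
    rw [← encard_lt_top_iff, hmax]; exact h
  refine ⟨hfin.toFinset, fun x hx => ?_, ?_⟩
  · by_contra hcon
    simp only [mem_iUnion, Metric.mem_closedBall, Subtype.exists, Finite.mem_toFinset,
      exists_prop, not_exists, not_and, not_le] at hcon
    have hxS : x ∉ S := fun hxS => by
      have := hcon x hxS
      rw [dist_self] at this
      linarith
    have hle : (insert x S).encard ≤ separationNumber r A := by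
      refine le_iSup₂ (f := fun (S : Set X) (_ : S ⊆ A ∧ IsRSeparated r S) => S.encard)
        (insert x S) ⟨insert_subset hx hS.1, ?_⟩
      refine hS.2.insert fun y hy _ => ⟨(hcon y hy).le, ?_⟩
      rw [dist_comm]
      exact (hcon y hy).le
    -- An uncovered point could be added to a separated set of largest cardinality.
    rw [encard_insert_of_notMem hxS, hmax] at hle
    exact absurd (ENat.add_one_le_iff h.ne |>.1 hle) (lt_irrefl _)
  · rw [← hmax, hfin.encard_eq_coe_toFinset_card]

theorem dimH_le_upperBoxDim (A : Set X) : dimH A ≤ upperBoxDim A := by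
  borelize X
  refine le_of_forall_gt_imp_ge_of_dense fun d hd => ?_
  induction d with
  | top => exact le_top
  | coe d =>
  have hlim : limsup (fun r : ℝ => ENNReal.log (separationNumber r A : ℝ≥0∞) /
      ((-Real.log r : ℝ) : EReal)) (𝓝[>] (0 : ℝ)) < ((d : ℝ) : EReal) := by
    have h1 : ((upperBoxDim A : ℝ≥0∞) : EReal) < ((d : ℝ≥0∞) : EReal) :=
      EReal.coe_ennreal_lt_coe_ennreal_iff.2 hd
    -- `toENNReal` truncates at `0`; the limsup itself can be negative, as for the empty set.
    rw [upperBoxDim, EReal.coe_toENNReal_eq_max] at h1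
    exact (le_max_right _ _).trans_lt h1
  have hev : ∀ᶠ r : ℝ in 𝓝[>] 0, ∃ S : Finset X,
      A ⊆ ⋃ s : S, Metric.closedBall (s : X) r ∧ (S.card : ℝ) ≤ r ^ (-(d : ℝ)) := by
    filter_upwards [eventually_lt_of_limsup_lt hlim, Ioo_mem_nhdsGT (zero_lt_one' ℝ)]
      with r hr hr01
    have hlog : 0 < -Real.log r := neg_pos.2 (Real.log_neg hr01.1 hr01.2)
    rw [EReal.div_lt_iff (EReal.coe_pos.2 hlog) (EReal.coe_ne_top _), ← EReal.coe_mul] at hr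
    have hN : (separationNumber r A : ℝ≥0∞) < ENNReal.ofReal (r ^ (-(d : ℝ))) := by
      rw [← ENNReal.log_lt_log_iff, ENNReal.log_ofReal_of_pos (Real.rpow_pos_of_pos hr01.1 _),
        Real.log_rpow hr01.1]
      convert hr using 2
      ring
    have htop : separationNumber r A < ⊤ := by
      by_contra hcon
      rw [not_lt_top_iff] at hcon
      rw [hcon] at hN
      simp at hN
    obtain ⟨S, hS, hcard⟩ := exists_finset_cover_of_separationNumber_lt_top hr01.1 htop
    refine ⟨S, hS, ?_⟩
    have h2 : ((S.card : ℕ∞) : ℝ≥0∞) ≤ ENNReal.ofReal (r ^ (-(d : ℝ))) :=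
      (ENat.toENNReal_le.2 hcard).trans hN.le
    rw [ENat.toENNReal_coe, ← ENNReal.ofReal_natCast] at h2
    exact (ENNReal.ofReal_le_ofReal_iff (Real.rpow_nonneg hr01.1.le _)).1 h2
  obtain ⟨S, hS⟩ := hev.choice
  have hpos : ∀ᶠ r : ℝ in 𝓝[>] 0, 0 < r := eventually_mem_nhdsWithin
  have hdiam : ∀ (r : ℝ) (s : X), 0 < r →
      Metric.ediam (Metric.closedBall s r) ≤ ENNReal.ofReal (2 * r) := fun r s hr => by
    rw [← Metric.closedEBall_ofReal hr.le, ENNReal.ofReal_mul zero_le_two]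
    simpa using Metric.ediam_closedEBall_le (x := s) (r := ENNReal.ofReal r)
  refine dimH_le_of_hausdorffMeasure_ne_top (ne_top_of_le_ne_top
    (ENNReal.ofReal_ne_top (r := (2 : ℝ) ^ (d : ℝ))) ?_)
  refine (MeasureTheory.Measure.hausdorffMeasure_le_liminf_sum (d : ℝ) A
    (l := 𝓝[>] (0 : ℝ)) (fun r : ℝ => ENNReal.ofReal (2 * r)) ?_
    (fun r (s : S r) => Metric.closedBall (s : X) r) ?_ ?_).trans ?_
  · have : Tendsto (fun r : ℝ => ENNReal.ofReal (2 * r)) (𝓝 0) (𝓝 (ENNReal.ofReal (2 * 0))) :=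
      ENNReal.tendsto_ofReal ((continuous_const.mul continuous_id).tendsto 0)
    rw [mul_zero, ENNReal.ofReal_zero] at this
    exact this.mono_left nhdsWithin_le_nhds
  · filter_upwards [hpos] with r hr s using hdiam r s hr
  · filter_upwards [hS] with r hr using hr.1
  · refine liminf_le_of_frequently_le' (Eventually.frequently ?_)
    filter_upwards [hS, hpos] with r hr hr0
    calc ∑ s : S r, Metric.ediam (Metric.closedBall (s : X) r) ^ (d : ℝ)
        ≤ ∑ _s : S r, ENNReal.ofReal ((2 * r) ^ (d : ℝ)) := by
          refine Finset.sum_le_sum fun s _ => ?_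
          rw [← ENNReal.ofReal_rpow_of_pos (by positivity)]
          exact ENNReal.rpow_le_rpow (hdiam r s hr0) d.2
      _ = ENNReal.ofReal ((S r).card * (2 * r) ^ (d : ℝ)) := by
          rw [Finset.sum_const, Finset.card_univ, Fintype.card_coe, nsmul_eq_mul,
            ENNReal.ofReal_mul (Nat.cast_nonneg _), ENNReal.ofReal_natCast]
      _ ≤ ENNReal.ofReal ((2 : ℝ) ^ (d : ℝ)) := by
          refine ENNReal.ofReal_le_ofReal ?_
          calc ((S r).card : ℝ) * (2 * r) ^ (d : ℝ)
              ≤ r ^ (-(d : ℝ)) * (2 * r) ^ (d : ℝ) := by gcongr; exact hr.2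
            _ = (2 : ℝ) ^ (d : ℝ) := by
              rw [Real.mul_rpow zero_le_two hr0.le, Real.rpow_neg hr0.le]
              have := (Real.rpow_pos_of_pos hr0 (d : ℝ)).ne'
              field_simp

theorem dimH_le_packingDim (A : Set X) : dimH A ≤ packingDim A := by
  refine le_iInf₂ fun B hB => ?_
  rw [hB, dimH_iUnion]
  exact iSup_mono fun i => dimH_le_upperBoxDim (B i)

/-- The constant is harmless because `log K / (-log r)` tends to `0`. -/
theorem upperBoxDim_le_of_separationNumber_le {A : Set X} {K s : ℝ} (hK : 0 < K)
    (h : ∀ᶠ r : ℝ in 𝓝[>] 0, (separationNumber r A : ℝ≥0∞) ≤ ENNReal.ofReal (K * r ^ (-s))) :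
    upperBoxDim A ≤ ENNReal.ofReal s := by
  rw [← EReal.real_coe_toENNReal]
  refine EReal.toENNReal_le_toENNReal ?_
  have hlim : Tendsto (fun r : ℝ => (((Real.log K / -Real.log r + s : ℝ)) : EReal)) (𝓝[>] 0)
      (𝓝 ((s : ℝ) : EReal)) := by
    refine (continuous_coe_real_ereal.tendsto s).comp ?_
    have h1 : Tendsto (fun r : ℝ => -Real.log r) (𝓝[>] 0) atTop :=
      tendsto_neg_atBot_atTop.comp Real.tendsto_log_nhdsGT_zero
    simpa using (h1.const_div_atTop (Real.log K)).add_const s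
  rw [← hlim.limsup_eq]
  refine limsup_le_limsup ?_
  filter_upwards [h, Ioo_mem_nhdsGT (zero_lt_one' ℝ)] with r hr hr01
  have hlog : 0 < -Real.log r := neg_pos.2 (Real.log_neg hr01.1 hr01.2)
  have hrp := Real.rpow_pos_of_pos hr01.1 (-s)
  have h2 := ENNReal.log_le_log hr
  rw [ENNReal.log_ofReal_of_pos (mul_pos hK hrp), Real.log_mul hK.ne' hrp.ne',
    Real.log_rpow hr01.1] at h2
  refine (EReal.div_le_div_right_of_nonneg (EReal.coe_nonneg.2 hlog.le) h2).trans ?_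
  rw [← EReal.coe_div, EReal.coe_le_coe_iff]
  refine le_of_eq ?_
  have := hlog.ne'
  rw [add_div, neg_mul_comm, mul_div_cancel_right₀ _ this]

theorem upperBoxDim_singleton (x : X) : upperBoxDim ({x} : Set X) = 0 := by
  refine le_antisymm ?_ zero_le
  rw [← ENNReal.ofReal_zero]
  refine upperBoxDim_le_of_separationNumber_le one_pos (Eventually.of_forall fun r => ?_)
  simp only [neg_zero, Real.rpow_zero, mul_one, ENNReal.ofReal_one]
  rw [← ENat.toENNReal_one, ENat.toENNReal_le]
  refine iSup₂_le fun S hS => ?_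
  rw [← encard_singleton x]
  exact encard_le_encard hS.1

/-- Decompose into `A` and the singletons of `B`, which have box dimension `0`. -/
theorem packingDim_union_countable_le {A B : Set X} (hB : B.Countable) :
    packingDim (A ∪ B) ≤ upperBoxDim A := by
  obtain rfl | hne := B.eq_empty_or_nonempty
  · refine (iInf₂_le (fun _ => A) (by rw [union_empty, iUnion_const])).trans ?_
    simp
  obtain ⟨f, rfl⟩ := hB.exists_eq_range hne
  refine (iInf₂_le (fun n => Nat.casesOn n A fun k => {f k}) ?_).trans ?_
  · ext x
    simp only [mem_union, mem_range, mem_iUnion]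
    constructor
    · rintro (h | ⟨k, rfl⟩)
      · exact ⟨0, h⟩
      · exact ⟨k + 1, rfl⟩
    · rintro ⟨_ | k, h⟩
      · exact Or.inl h
      · exact Or.inr ⟨k, (mem_singleton_iff.1 h).symm⟩
  · refine iSup_le fun n => ?_
    cases n with
    | zero => exact le_rfl
    | succ k => exact (upperBoxDim_singleton (f k)).trans_le zero_le

end BoxDimension

/-! ### Dimensions of the Cantor set and of its subsets with prescribed zero digits. -/

section CantorDimension

/-- The point of the Cantor set whose `i`-th ternary digit is `2` if `b i` holds and `0` if not. -/
noncomputable def cantorPoint (b : ℕ → Bool) : ℝ :=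
  Real.ofDigits fun i => cond (b i) (2 : Fin 3) 0

theorem cantorPoint_mem_cantorSet (b : ℕ → Bool) : cantorPoint b ∈ cantorSet :=
  ofDigits_bool_to_fin_three_mem_cantorSet b

/-- The real number with binary digits `b`. -/
noncomputable def binaryPoint (b : ℕ → Bool) : ℝ :=
  Real.ofDigits fun i => cond (b i) (1 : Fin 2) 0

theorem Icc_subset_range_binaryPoint : Icc (0 : ℝ) 1 ⊆ range binaryPoint := by
  intro y hy
  obtain ⟨a, -, rfl⟩ := Real.ofDigits_SurjOn (b := 2) one_lt_two hy
  refine ⟨fun i => decide (a i = 1), ?_⟩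
  unfold binaryPoint
  congr 1
  funext i
  exact (by decide : ∀ d : Fin 2, cond (decide (d = 1)) (1 : Fin 2) 0 = d) (a i)

theorem abs_binaryPoint_sub_le {b c : ℕ → Bool} {n : ℕ} (h : ∀ i < n, b i = c i) :
    |binaryPoint b - binaryPoint c| ≤ ((2 : ℝ) ^ n)⁻¹ := by
  have := Real.abs_ofDigits_sub_ofDigits_le (b := 2) (n := n)
    (x := fun i => cond (b i) (1 : Fin 2) 0) (y := fun i => cond (c i) (1 : Fin 2) 0)
    (fun i hi => by rw [h i hi])
  exact_mod_cast this

/-- The first differing digit contributes `2 / 3 ^ (n + 1)`, and the tails can cancel at most `1 / 3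
^ (n + 1)` of it. -/
theorem inv_pow_le_abs_cantorPoint_sub {b c : ℕ → Bool} {n : ℕ} (h : ∀ i < n, b i = c i)
    (hn : b n ≠ c n) : ((3 : ℝ) ^ (n + 1))⁻¹ ≤ |cantorPoint b - cantorPoint c| := by
  wlog hb : b n = true generalizing b c
  · rw [abs_sub_comm]
    refine this (fun i hi => (h i hi).symm) hn.symm ?_
    revert hn hb
    cases b n <;> cases c n <;> simp
  have hc : c n = false := by
    rw [hb] at hn
    simpa using hn.symm
  have hsum : ∑ i ∈ Finset.range n, Real.ofDigitsTerm (fun i => cond (b i) (2 : Fin 3) 0) i =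
      ∑ i ∈ Finset.range n, Real.ofDigitsTerm (fun i => cond (c i) (2 : Fin 3) 0) i :=
    Finset.sum_congr rfl fun i hi => by
      simp only [Real.ofDigitsTerm, h i (Finset.mem_range.1 hi)]
  unfold cantorPoint
  rw [Real.ofDigits_eq_sum_add_ofDigits _ (n + 1),
    Real.ofDigits_eq_sum_add_ofDigits (fun i => cond (c i) (2 : Fin 3) 0) (n + 1),
    Finset.sum_range_succ, Finset.sum_range_succ, hsum]
  have h1 := Real.ofDigits_nonneg (fun i => cond (b (i + (n + 1))) (2 : Fin 3) 0)
  have h2 := Real.ofDigits_le_one (fun i => cond (c (i + (n + 1))) (2 : Fin 3) 0)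
  refine le_trans ?_ (le_abs_self _)
  have h3 : 0 < ((3 : ℝ) ^ (n + 1))⁻¹ := by positivity
  simp only [Real.ofDigitsTerm, hb, hc, cond_true, cond_false]
  push_cast
  simp only [Fin.isValue, Fin.val_zero, Fin.val_two, Nat.cast_zero, Nat.cast_ofNat]
  nlinarith

/-- The binary sequence with value `c j` at position `u j`, and `false` elsewhere. -/
noncomputable def spreadDigits (u : ℕ → ℕ) (c : ℕ → Bool) (i : ℕ) : Bool :=
  open Classical in decide (∃ j, u j = i ∧ c j = true)

theorem spreadDigits_eq_true_iff {u : ℕ → ℕ} {c : ℕ → Bool} {i : ℕ} :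
    spreadDigits u c i = true ↔ ∃ j, u j = i ∧ c j = true := by
  simp [spreadDigits]

theorem spreadDigits_apply {u : ℕ → ℕ} (hu : StrictMono u) (c : ℕ → Bool) (j : ℕ) :
    spreadDigits u c (u j) = c j := by
  rw [Bool.eq_iff_iff, spreadDigits_eq_true_iff]
  refine ⟨?_, fun h => ⟨j, rfl, h⟩⟩
  rintro ⟨k, hk, hck⟩
  rwa [← hu.injective hk]

theorem spreadDigits_congr {u : ℕ → ℕ} (hu : StrictMono u) {c d : ℕ → Bool} {n : ℕ}
    (h : ∀ j < n, c j = d j) : ∀ i < u n, spreadDigits u c i = spreadDigits u d i := by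
  intro i hi
  rw [Bool.eq_iff_iff, spreadDigits_eq_true_iff, spreadDigits_eq_true_iff]
  refine exists_congr fun j => and_congr_right fun hj => ?_
  rw [h j (hu.lt_iff_lt.1 (hj ▸ hi))]

theorem exists_first_difference {c d : ℕ → Bool} (h : c ≠ d) :
    ∃ n, (∀ i < n, c i = d i) ∧ c n ≠ d n := by
  classical
  have h' := Function.ne_iff.1 h
  exact ⟨Nat.find h', fun i hi => not_not.1 (Nat.find_min h' hi), Nat.find_spec h'⟩

/-- If the positions `u` carrying free digits grow at most like `K j`, then the points of the
Cantor set with free digits there and zero digits elsewhere have dimension at least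
`log 2 / (K log 3)`. -/
theorem le_dimH_range_cantorPoint_spreadDigits {u : ℕ → ℕ} (hu : StrictMono u) {K : ℕ}
    (hK : 0 < K) (huK : ∀ j, u j + 1 ≤ K * (j + 1)) :
    ENNReal.ofReal (Real.log 2 / (K * Real.log 3)) ≤
      dimH (range fun c => cantorPoint (spreadDigits u c)) := by
  set g : (ℕ → Bool) → ℝ := fun c => cantorPoint (spreadDigits u c) with hg
  have hlog2 : 0 < Real.log 2 := Real.log_pos one_lt_two
  have hlog3 : 0 < Real.log 3 := Real.log_pos (by norm_num)
  have hK' : (0 : ℝ) < K := Nat.cast_pos.2 hK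
  -- This exponent satisfies `(3 ^ (-K)) ^ α = 1 / 2`. It makes the map from `g c` to `binaryPoint
  -- c` Hölder of exponent `α`; since that map covers `[0, 1]`, the domain has dimension at least
  -- `α`.
  set α : ℝ := Real.log 2 / (K * Real.log 3) with hα
  have hα0 : 0 < α := by positivity
  have hpow : ∀ n : ℕ, (((3 : ℝ) ^ (K * n))⁻¹) ^ α = ((2 : ℝ) ^ n)⁻¹ := fun n => by
    rw [Real.inv_rpow (by positivity), ← Real.rpow_natCast, ← Real.rpow_mul (by norm_num),
      ← Real.rpow_natCast 2 n, Real.rpow_def_of_pos (by norm_num),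
      Real.rpow_def_of_pos (by norm_num : (0 : ℝ) < 2)]
    congr 2
    rw [hα]
    push_cast
    field_simp
  have key : ∀ c d, |binaryPoint c - binaryPoint d| ≤ 2 * |g c - g d| ^ α := by
    intro c d
    by_cases hcd : c = d
    · rw [hcd, sub_self, abs_zero]
      positivity
    obtain ⟨n, hn, hne⟩ := exists_first_difference hcd
    have h1 := inv_pow_le_abs_cantorPoint_sub (spreadDigits_congr hu hn)
      (by rwa [spreadDigits_apply hu, spreadDigits_apply hu])
    have h2 : ((3 : ℝ) ^ (K * (n + 1)))⁻¹ ≤ |g c - g d| := by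
      refine le_trans ?_ h1
      gcongr
      · norm_num
      · exact huK n
    calc |binaryPoint c - binaryPoint d| ≤ ((2 : ℝ) ^ n)⁻¹ := abs_binaryPoint_sub_le hn
      _ = 2 * ((2 : ℝ) ^ (n + 1))⁻¹ := by rw [pow_succ]; field_simp
      _ = 2 * (((3 : ℝ) ^ (K * (n + 1)))⁻¹) ^ α := by rw [hpow]
      _ ≤ 2 * |g c - g d| ^ α := by gcongr
  have hinj : Function.Injective g := by
    intro c d hcd
    by_contra hne
    obtain ⟨n, hn, hne⟩ := exists_first_difference hne
    have h1 := inv_pow_le_abs_cantorPoint_sub (spreadDigits_congr hu hn)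
      (by rwa [spreadDigits_apply hu, spreadDigits_apply hu])
    have h2 : |cantorPoint (spreadDigits u c) - cantorPoint (spreadDigits u d)| = 0 := by
      rw [abs_eq_zero, sub_eq_zero]
      exact hcd
    rw [h2] at h1
    exact absurd h1 (not_le.2 (by positivity))
  set f : ℝ → ℝ := fun x => binaryPoint (Function.invFun g x)
  have hfg : ∀ c, f (g c) = binaryPoint c := fun c => by
    simp only [f, Function.leftInverse_invFun hinj c]
  have hf : HolderOnWith 2 α.toNNReal f (range g) := by
    rintro _ ⟨c, rfl⟩ _ ⟨d, rfl⟩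
    rw [hfg, hfg, edist_dist, edist_dist, Real.dist_eq, Real.dist_eq, Real.coe_toNNReal _ hα0.le,
      ENNReal.ofReal_rpow_of_nonneg (abs_nonneg _) hα0.le]
    have : ((2 : NNReal) : ℝ≥0∞) = ENNReal.ofReal 2 := by simp
    rw [this, ← ENNReal.ofReal_mul zero_le_two]
    exact ENNReal.ofReal_le_ofReal (key c d)
  have himage : Icc (0 : ℝ) 1 ⊆ f '' range g := by
    intro y hy
    obtain ⟨c, rfl⟩ := Icc_subset_range_binaryPoint hy
    exact ⟨g c, mem_range_self c, hfg c⟩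
  have h1 : (1 : ℝ≥0∞) ≤ dimH (f '' range g) := by
    refine le_trans (le_of_eq ?_) (dimH_mono himage)
    rw [Real.dimH_of_nonempty_interior (by rw [interior_Icc]; exact nonempty_Ioo.2 one_pos)]
    simp
  have hα1 : 0 < α.toNNReal := Real.toNNReal_pos.2 hα0
  have h2 := h1.trans (hf.dimH_image_le hα1)
  rwa [ENNReal.le_div_iff_mul_le (Or.inl (ENNReal.coe_ne_zero.2 hα1.ne'))
    (Or.inl ENNReal.coe_ne_top), one_mul] at h2

theorem le_dimH_cantorSet : ENNReal.ofReal (Real.log 2 / Real.log 3) ≤ dimH cantorSet := by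
  have h := le_dimH_range_cantorPoint_spreadDigits strictMono_id one_pos (fun j => by simp)
  rw [Nat.cast_one, one_mul] at h
  refine h.trans (dimH_mono ?_)
  rintro _ ⟨c, rfl⟩
  exact cantorPoint_mem_cantorSet _

/-- Rescaling each of the two halves of the Cantor set by `3` triples the separation, so each step
of the induction costs a factor `2`. -/
theorem encard_le_two_pow_of_isRSeparated (n : ℕ) {r : ℝ} (hr : ((3 : ℝ) ^ n)⁻¹ < r) {A : Set ℝ}
    (hA : A ⊆ cantorSet) (hsep : IsRSeparated r A) : A.encard ≤ 2 ^ n := by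
  induction n generalizing r A with
  | zero =>
    rw [pow_zero, encard_le_one_iff]
    intro x y hx hy
    by_contra hne
    have h1 := hsep hx hy hne
    have hx' := cantorSet_subset_unitInterval (hA hx)
    have hy' := cantorSet_subset_unitInterval (hA hy)
    have := Real.dist_le_of_mem_Icc_01 hx' hy'
    rw [pow_zero, inv_one] at hr
    linarith
  | succ n ih =>
    have hr3 : ((3 : ℝ) ^ n)⁻¹ < 3 * r := by
      rw [pow_succ, mul_inv] at hr
      linarith
    set B : Set ℝ := (fun x => x / 3) ⁻¹' A ∩ cantorSet
    set B' : Set ℝ := (fun x => (2 + x) / 3) ⁻¹' A ∩ cantorSet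
    have hcover : A ⊆ (fun x => x / 3) '' B ∪ (fun x => (2 + x) / 3) '' B' := by
      intro x hx
      have hxC := hA hx
      rw [cantorSet_eq_union_halves] at hxC
      rcases hxC with ⟨y, hy, rfl⟩ | ⟨y, hy, rfl⟩
      · exact Or.inl ⟨y, ⟨hx, hy⟩, rfl⟩
      · exact Or.inr ⟨y, ⟨hx, hy⟩, rfl⟩
    have hB : B.encard ≤ 2 ^ n := by
      refine ih hr3 inter_subset_right fun x hx y hy hxy => ?_
      have : r ≤ dist (x / 3) (y / 3) := hsep hx.1 hy.1 (fun h => hxy (by linarith))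
      rw [Real.dist_eq, ← sub_div, abs_div, abs_of_pos (by norm_num : (0 : ℝ) < 3)] at this
      change 3 * r ≤ |x - y|
      linarith
    have hB' : B'.encard ≤ 2 ^ n := by
      refine ih hr3 inter_subset_right fun x hx y hy hxy => ?_
      have : r ≤ dist ((2 + x) / 3) ((2 + y) / 3) :=
        hsep hx.1 hy.1 (fun h => hxy (by linarith))
      rw [Real.dist_eq, ← sub_div, abs_div, abs_of_pos (by norm_num : (0 : ℝ) < 3),
        add_sub_add_left_eq_sub] at this
      change 3 * r ≤ |x - y|
      linarith
    calc A.encard ≤ _ := encard_le_encard hcover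
      _ ≤ _ := encard_union_le _ _
      _ ≤ B.encard + B'.encard := add_le_add (encard_image_le _ _) (encard_image_le _ _)
      _ ≤ 2 ^ n + 2 ^ n := add_le_add hB hB'
      _ = 2 ^ (n + 1) := by rw [pow_succ, mul_two]

theorem separationNumber_cantorSet_le {r : ℝ} (hr : 0 < r) (hr1 : r < 1) :
    (separationNumber r cantorSet : ℝ≥0∞) ≤
      ENNReal.ofReal (2 * r ^ (-(Real.log 2 / Real.log 3))) := by
  have hlog3 : 0 < Real.log 3 := Real.log_pos (by norm_num)
  -- Here `3 ^ (-(n + 1)) < r ≤ 3 ^ (-n)`; the index shift accounts for the factor `2` in the bound.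
  obtain ⟨n, hn, hn'⟩ := exists_nat_pow_near_of_lt_one hr hr1.le
    (by norm_num : (0 : ℝ) < 3⁻¹) (by norm_num)
  rw [inv_pow] at hn hn'
  have h1 : separationNumber r cantorSet ≤ 2 ^ (n + 1) :=
    iSup₂_le fun S hS => encard_le_two_pow_of_isRSeparated (n + 1) hn hS.1 hS.2
  have h2 : (separationNumber r cantorSet : ℝ≥0∞) ≤ 2 ^ (n + 1) := by
    have := ENat.toENNReal_le.2 h1
    simpa using this
  refine h2.trans ?_
  have h3 : (2 : ℝ) ^ n ≤ r ^ (-(Real.log 2 / Real.log 3)) := by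
    have h4 : (2 : ℝ) ^ n = (((3 : ℝ) ^ n)⁻¹) ^ (-(Real.log 2 / Real.log 3)) := by
      rw [Real.rpow_neg (by positivity), Real.inv_rpow (by positivity), inv_inv,
        ← Real.rpow_natCast, ← Real.rpow_natCast, ← Real.rpow_mul (by norm_num),
        Real.rpow_def_of_pos (by norm_num), Real.rpow_def_of_pos (by norm_num : (0 : ℝ) < 3)]
      congr 1
      field_simp
    rw [h4]
    exact Real.rpow_le_rpow_of_nonpos hr hn' (neg_nonpos.2 (div_nonneg
      (Real.log_nonneg one_le_two) hlog3.le))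
  have h5 : (2 : ℝ≥0∞) ^ (n + 1) = ENNReal.ofReal (2 * 2 ^ n) := by
    rw [← pow_succ', ENNReal.ofReal_pow zero_le_two]
    simp
  rw [h5]
  exact ENNReal.ofReal_le_ofReal (by linarith)

theorem upperBoxDim_cantorSet_le :
    upperBoxDim cantorSet ≤ ENNReal.ofReal (Real.log 2 / Real.log 3) := by
  refine upperBoxDim_le_of_separationNumber_le two_pos ?_
  filter_upwards [Ioo_mem_nhdsGT (zero_lt_one' ℝ)] with r hr
  exact separationNumber_cantorSet_le hr.1 hr.2

theorem dimH_cantorSet_union_eq_packingDim {B : Set ℝ} (hB : B.Countable) :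
    dimH (cantorSet ∪ B) = packingDim (cantorSet ∪ B) := by
  refine le_antisymm (dimH_le_packingDim _) ?_
  calc packingDim (cantorSet ∪ B) ≤ upperBoxDim cantorSet := packingDim_union_countable_le hB
    _ ≤ ENNReal.ofReal (Real.log 2 / Real.log 3) := upperBoxDim_cantorSet_le
    _ ≤ dimH cantorSet := le_dimH_cantorSet
    _ ≤ dimH (cantorSet ∪ B) := dimH_mono subset_union_left

end CantorDimension

/-! ### Self-similarity and compactness of the Cantor set with midpoints. -/

section SelfSimilarity

/-- The union of the two thirds-scaled copies of `A` in `[0, 1/3]` and `[2/3, 1]`, together with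
the point `1/2`. -/
def trisect (A : Set ℝ) : Set ℝ :=
  insert (1 / 2) ((fun x => x / 3) '' A ∪ (fun x => (2 + x) / 3) '' A)

/-- The middle-third Cantor set together with the midpoints of its gaps. -/
def cantorWithMidpoints : Set ℝ := cantorSet ∪ gapMidpoints cantorSet

theorem half_mem_trisect (A : Set ℝ) : 1 / 2 ∈ trisect A := mem_insert _ _

theorem div_three_mem_trisect {A : Set ℝ} {x : ℝ} (hx : x ∈ A) : x / 3 ∈ trisect A :=
  Or.inr (Or.inl ⟨x, hx, rfl⟩)

theorem two_add_div_three_mem_trisect {A : Set ℝ} {x : ℝ} (hx : x ∈ A) :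
    (2 + x) / 3 ∈ trisect A :=
  Or.inr (Or.inr ⟨x, hx, rfl⟩)

theorem trisect_mono {A B : Set ℝ} (h : A ⊆ B) : trisect A ⊆ trisect B :=
  insert_subset_insert (union_subset_union (image_mono h) (image_mono h))

theorem isCompact_trisect {A : Set ℝ} (h : IsCompact A) : IsCompact (trisect A) :=
  ((h.image (by fun_prop)).union (h.image (by fun_prop))).insert _

theorem div_three_mem_cantorSet {x : ℝ} (hx : x ∈ cantorSet) : x / 3 ∈ cantorSet := by
  rw [cantorSet_eq_union_halves]
  exact Or.inl ⟨x, hx, rfl⟩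

theorem two_add_div_three_mem_cantorSet {x : ℝ} (hx : x ∈ cantorSet) :
    (2 + x) / 3 ∈ cantorSet := by
  rw [cantorSet_eq_union_halves]
  exact Or.inr ⟨x, hx, rfl⟩

theorem cantorSet_thirds {x : ℝ} (hx : x ∈ cantorSet) :
    (x ≤ 1 / 3 ∧ 3 * x ∈ cantorSet) ∨ (2 / 3 ≤ x ∧ 3 * x - 2 ∈ cantorSet) := by
  rw [cantorSet_eq_union_halves] at hx
  rcases hx with ⟨y, hy, rfl⟩ | ⟨y, hy, rfl⟩
  · left
    have := (cantorSet_subset_unitInterval hy).2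
    refine ⟨by linarith, ?_⟩
    rwa [mul_div_cancel₀ y three_ne_zero]
  · right
    have := (cantorSet_subset_unitInterval hy).1
    refine ⟨by linarith, ?_⟩
    rwa [mul_div_cancel₀ _ three_ne_zero, add_sub_cancel_left]

theorem one_mem_cantorSet : (1 : ℝ) ∈ cantorSet := by
  refine mem_iInter.2 fun n => ?_
  induction n with
  | zero => simp
  | succ n ih => exact Or.inr ⟨1, ih, by norm_num⟩

theorem third_mem_cantorSet : (1 / 3 : ℝ) ∈ cantorSet :=
  div_three_mem_cantorSet one_mem_cantorSet

theorem two_thirds_mem_cantorSet : (2 / 3 : ℝ) ∈ cantorSet := by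
  have := two_add_div_three_mem_cantorSet zero_mem_cantorSet
  rwa [add_zero] at this

/-- A gap of the Cantor set lies in the left third, in the right third, or is the middle third. -/
theorem cantorSet_gap_cases {a b : ℝ} (ha : a ∈ cantorSet) (hb : b ∈ cantorSet) (hab : a < b)
    (hd : Disjoint (Ioo a b) cantorSet) :
    (a = 1 / 3 ∧ b = 2 / 3) ∨
    (3 * a ∈ cantorSet ∧ 3 * b ∈ cantorSet ∧ Disjoint (Ioo (3 * a) (3 * b)) cantorSet) ∨
    (3 * a - 2 ∈ cantorSet ∧ 3 * b - 2 ∈ cantorSet ∧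
      Disjoint (Ioo (3 * a - 2) (3 * b - 2)) cantorSet) := by
  have hd' : ∀ x ∈ cantorSet, x ≤ a ∨ b ≤ x := fun x hx => by
    by_contra hcon
    rw [not_or, not_le, not_le] at hcon
    exact disjoint_left.1 hd hcon hx
  rcases cantorSet_thirds ha with ⟨ha1, ha2⟩ | ⟨ha1, ha2⟩
  · rcases cantorSet_thirds hb with ⟨hb1, hb2⟩ | ⟨hb1, hb2⟩
    · refine Or.inr (Or.inl ⟨ha2, hb2, disjoint_left.2 fun x hx hxC => ?_⟩)
      rcases hd' _ (div_three_mem_cantorSet hxC) with h | h <;> linarith [hx.1, hx.2]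
    · left
      rcases hd' _ third_mem_cantorSet with h | h <;>
      rcases hd' _ two_thirds_mem_cantorSet with h' | h' <;>
      constructor <;> linarith
  · rcases cantorSet_thirds hb with ⟨hb1, hb2⟩ | ⟨hb1, hb2⟩
    · linarith
    · refine Or.inr (Or.inr ⟨ha2, hb2, disjoint_left.2 fun x hx hxC => ?_⟩)
      rcases hd' _ (two_add_div_three_mem_cantorSet hxC) with h | h <;> linarith [hx.1, hx.2]

theorem div_three_mem_gapMidpoints {m : ℝ} (hm : m ∈ gapMidpoints cantorSet) :
    m / 3 ∈ gapMidpoints cantorSet := by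
  obtain ⟨a, ha, b, hb, hab, hd, rfl⟩ := hm
  have hb1 := (cantorSet_subset_unitInterval hb).2
  refine ⟨a / 3, div_three_mem_cantorSet ha, b / 3, div_three_mem_cantorSet hb, by linarith,
    disjoint_left.2 fun x hx hxC => ?_, by ring⟩
  rcases cantorSet_thirds hxC with ⟨h, h'⟩ | ⟨h, h'⟩
  · exact disjoint_left.1 hd ⟨by linarith [hx.1], by linarith [hx.2]⟩ h'
  · linarith [hx.2]

theorem two_add_div_three_mem_gapMidpoints {m : ℝ} (hm : m ∈ gapMidpoints cantorSet) :
    (2 + m) / 3 ∈ gapMidpoints cantorSet := by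
  obtain ⟨a, ha, b, hb, hab, hd, rfl⟩ := hm
  have ha0 := (cantorSet_subset_unitInterval ha).1
  refine ⟨(2 + a) / 3, two_add_div_three_mem_cantorSet ha, (2 + b) / 3,
    two_add_div_three_mem_cantorSet hb, by linarith,
    disjoint_left.2 fun x hx hxC => ?_, by ring⟩
  rcases cantorSet_thirds hxC with ⟨h, h'⟩ | ⟨h, h'⟩
  · linarith [hx.1]
  · exact disjoint_left.1 hd ⟨by linarith [hx.1], by linarith [hx.2]⟩ h'

theorem half_mem_gapMidpoints : (1 / 2 : ℝ) ∈ gapMidpoints cantorSet := by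
  refine ⟨1 / 3, third_mem_cantorSet, 2 / 3, two_thirds_mem_cantorSet, by norm_num,
    disjoint_left.2 fun x hx hxC => ?_, by norm_num⟩
  rcases cantorSet_thirds hxC with h | h
  · linarith [hx.1]
  · linarith [hx.2]

theorem gapMidpoints_subset_trisect :
    gapMidpoints cantorSet ⊆ trisect (gapMidpoints cantorSet) := by
  rintro _ ⟨a, ha, b, hb, hab, hd, rfl⟩
  rcases cantorSet_gap_cases ha hb hab hd with ⟨rfl, rfl⟩ | ⟨h1, h2, h3⟩ | ⟨h1, h2, h3⟩
  · convert half_mem_trisect _ using 1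
    norm_num
  · convert div_three_mem_trisect (A := gapMidpoints cantorSet) (x := (3 * a + 3 * b) / 2)
      ⟨3 * a, h1, 3 * b, h2, by linarith, h3, rfl⟩ using 1
    ring
  · convert two_add_div_three_mem_trisect (A := gapMidpoints cantorSet) (x := (3 * a - 2 + (3 * b - 2)) / 2)
      ⟨3 * a - 2, h1, 3 * b - 2, h2, by linarith, h3, rfl⟩ using 1
    ring

/-- Every midpoint is rational: a gap other than the middle third is a scaled copy of one three
times as long, so after finitely many enlargements the middle third is reached. -/
theorem countable_gapMidpoints_cantorSet : (gapMidpoints cantorSet).Countable := by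
  have key : ∀ (n : ℕ) (a b : ℝ), a ∈ cantorSet → b ∈ cantorSet → ((3 : ℝ) ^ n)⁻¹ < b - a →
      Disjoint (Ioo a b) cantorSet → ∃ q : ℚ, (q : ℝ) = (a + b) / 2 := by
    intro n
    induction n with
    | zero =>
      intro a b ha hb hab
      have := (cantorSet_subset_unitInterval ha).1
      have := (cantorSet_subset_unitInterval hb).2
      rw [pow_zero, inv_one] at hab
      linarith
    | succ n ih =>
      intro a b ha hb hab hd
      have h0 : 0 < ((3 : ℝ) ^ (n + 1))⁻¹ := by positivity
      have h3 : ((3 : ℝ) ^ n)⁻¹ = 3 * ((3 : ℝ) ^ (n + 1))⁻¹ := by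
        rw [pow_succ]
        field_simp
      rcases cantorSet_gap_cases ha hb (by linarith) hd with
        ⟨rfl, rfl⟩ | ⟨h1, h2, hd'⟩ | ⟨h1, h2, hd'⟩
      · exact ⟨1 / 2, by norm_num⟩
      · obtain ⟨q, hq⟩ := ih _ _ h1 h2 (by linarith) hd'
        exact ⟨q / 3, by push_cast; rw [hq]; ring⟩
      · obtain ⟨q, hq⟩ := ih _ _ h1 h2 (by linarith) hd'
        exact ⟨(q + 2) / 3, by push_cast; rw [hq]; ring⟩
  refine (countable_range ((↑) : ℚ → ℝ)).mono ?_
  rintro _ ⟨a, ha, b, hb, hab, hd, rfl⟩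
  obtain ⟨n, hn⟩ := exists_pow_lt_of_lt_one (sub_pos.2 hab) (by norm_num : (3 : ℝ)⁻¹ < 1)
  rw [inv_pow] at hn
  exact key n a b ha hb hn hd

theorem trisect_cantorWithMidpoints : trisect cantorWithMidpoints = cantorWithMidpoints := by
  refine Subset.antisymm ?_ ?_
  · rintro _ (rfl | ⟨x, hx | hx, rfl⟩ | ⟨x, hx | hx, rfl⟩)
    · exact Or.inr half_mem_gapMidpoints
    · exact Or.inl (div_three_mem_cantorSet hx)
    · exact Or.inr (div_three_mem_gapMidpoints hx)
    · exact Or.inl (two_add_div_three_mem_cantorSet hx)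
    · exact Or.inr (two_add_div_three_mem_gapMidpoints hx)
  · rintro x (hx | hx)
    · rw [cantorSet_eq_union_halves] at hx
      exact trisect_mono subset_union_left (Or.inr hx)
    · exact trisect_mono subset_union_right (gapMidpoints_subset_trisect hx)

theorem cantorWithMidpoints_subset_Icc : cantorWithMidpoints ⊆ Icc 0 1 := by
  rintro x (hx | ⟨a, ha, b, hb, -, -, rfl⟩)
  · exact cantorSet_subset_unitInterval hx
  · have ha' := cantorSet_subset_unitInterval ha
    have hb' := cantorSet_subset_unitInterval hb
    constructor <;> linarith [ha'.1, ha'.2, hb'.1, hb'.2]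

/-- The set is the intersection of the compact iterates of `trisect` on `[0, 1]`, since the `n`-th
iterate adds only gap midpoints to `preCantorSet n`. -/
theorem isCompact_cantorWithMidpoints : IsCompact cantorWithMidpoints := by
  have hcompact : ∀ n, IsCompact (trisect^[n] (Icc 0 1)) := by
    intro n
    induction n with
    | zero => exact isCompact_Icc
    | succ n ih =>
      rw [Function.iterate_succ_apply']
      exact isCompact_trisect ih
  have hsub : ∀ n, cantorWithMidpoints ⊆ trisect^[n] (Icc 0 1) := by
    intro n
    induction n with
    | zero => exact cantorWithMidpoints_subset_Icc
    | succ n ih =>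
      rw [Function.iterate_succ_apply', ← trisect_cantorWithMidpoints]
      exact trisect_mono ih
  have hsub' : ∀ n, trisect^[n] (Icc 0 1) ⊆ preCantorSet n ∪ gapMidpoints cantorSet := by
    intro n
    induction n with
    | zero => exact subset_union_left
    | succ n ih =>
      rw [Function.iterate_succ_apply']
      refine (trisect_mono ih).trans ?_
      rintro _ (rfl | ⟨x, hx | hx, rfl⟩ | ⟨x, hx | hx, rfl⟩)
      · exact Or.inr half_mem_gapMidpoints
      · exact Or.inl (Or.inl ⟨x, hx, rfl⟩)
      · exact Or.inr (div_three_mem_gapMidpoints hx)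
      · exact Or.inl (Or.inr ⟨x, hx, rfl⟩)
      · exact Or.inr (two_add_div_three_mem_gapMidpoints hx)
  have heq : cantorWithMidpoints = ⋂ n, trisect^[n] (Icc 0 1) := by
    refine Subset.antisymm (subset_iInter hsub) fun x hx => ?_
    by_cases hM : x ∈ gapMidpoints cantorSet
    · exact Or.inr hM
    · exact Or.inl (mem_iInter.2 fun n => (hsub' n (mem_iInter.1 hx n)).resolve_right hM)
  rw [heq]
  exact (hcompact 0).of_isClosed_subset (isClosed_iInter fun n => (hcompact n).isClosed)
    (iInter_subset _ 0)

end SelfSimilarity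

/-! ### Separated nets, and nets that stay away from the Cantor set. -/

section SeparatedNets

/-- `A` is an `r`-separated subset of `F` whose open `r`-balls cover `F`. -/
def IsSeparatedNet (F : Set ℝ) (r : ℝ) (A : Set ℝ) : Prop :=
  A ⊆ F ∧ IsRSeparated r A ∧ ∀ x ∈ F, ∃ a ∈ A, dist x a < r

theorem IsSeparatedNet.maximal {F A : Set ℝ} {r : ℝ} (h : IsSeparatedNet F r A) :
    Maximal (fun S : Set ℝ => S ⊆ F ∧ IsRSeparated r S) A := by
  refine ⟨⟨h.1, h.2.1⟩, fun S hS hAS x hx => ?_⟩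
  obtain ⟨a, ha, hxa⟩ := h.2.2 x (hS.1 hx)
  by_cases hne : x = a
  · exact hne ▸ ha
  · exact absurd hxa (not_lt.2 (hS.2 hx (hAS ha) hne))

/-- The new point `1/2` is at distance at least `1/6` from both copies, whence the condition `r / 3
≤ 1/6`. -/
theorem IsSeparatedNet.trisect {A : Set ℝ} {r : ℝ} (hr : r ≤ 1 / 2)
    (h : IsSeparatedNet cantorWithMidpoints r A) :
    IsSeparatedNet cantorWithMidpoints (r / 3) (trisect A) := by
  have hI : ∀ a ∈ A, 0 ≤ a ∧ a ≤ 1 := fun a ha => cantorWithMidpoints_subset_Icc (h.1 ha)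
  have hs : ∀ x ∈ A, ∀ y ∈ A, x ≠ y → r ≤ |x - y| := fun x hx y hy => h.2.1 hx hy
  refine ⟨?_, ?_, ?_⟩
  · rw [← trisect_cantorWithMidpoints]
    exact trisect_mono h.1
  · have hsymm : ∀ x ∈ _root_.trisect A, ∀ y ∈ _root_.trisect A, x < y → r / 3 ≤ y - x := by
      rintro _ (rfl | ⟨x, hx, rfl⟩ | ⟨x, hx, rfl⟩) _ (rfl | ⟨y, hy, rfl⟩ | ⟨y, hy, rfl⟩) hlt <;>
      beta_reduce at hlt ⊢
      · exact absurd hlt (lt_irrefl _)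
      · linarith [hI y hy]
      · linarith [hI y hy]
      · linarith [hI x hx]
      · have := hs y hy x hx (fun h => by rw [h] at hlt; exact lt_irrefl _ hlt)
        rw [abs_of_pos (by linarith)] at this
        linarith
      · linarith [hI x hx, hI y hy]
      · linarith [hI x hx]
      · linarith [hI x hx, hI y hy]
      · have := hs y hy x hx (fun h => by rw [h] at hlt; exact lt_irrefl _ hlt)
        rw [abs_of_pos (by linarith)] at this
        linarith
    intro x hx y hy hne
    change r / 3 ≤ |x - y|
    rcases lt_or_gt_of_ne hne with hlt | hlt
    · rw [abs_sub_comm]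
      exact (hsymm x hx y hy hlt).trans (le_abs_self _)
    · exact (hsymm y hy x hx hlt).trans (le_abs_self _)
  · intro x hx
    have hr0 : 0 < r := by
      obtain ⟨a, -, ha⟩ := h.2.2 x hx
      exact dist_nonneg.trans_lt ha
    rw [← trisect_cantorWithMidpoints] at hx
    rcases hx with rfl | ⟨y, hy, rfl⟩ | ⟨y, hy, rfl⟩
    · exact ⟨1 / 2, half_mem_trisect A, by rw [dist_self]; linarith⟩
    · obtain ⟨a, ha, hya⟩ := h.2.2 y hy
      refine ⟨a / 3, div_three_mem_trisect ha, ?_⟩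
      rw [Real.dist_eq] at hya
      dsimp only
      rw [Real.dist_eq, ← sub_div, abs_div, abs_of_pos (by norm_num : (0 : ℝ) < 3)]
      linarith
    · obtain ⟨a, ha, hya⟩ := h.2.2 y hy
      refine ⟨(2 + a) / 3, two_add_div_three_mem_trisect ha, ?_⟩
      rw [Real.dist_eq] at hya
      dsimp only
      rw [Real.dist_eq, ← sub_div, abs_div, abs_of_pos (by norm_num : (0 : ℝ) < 3),
        add_sub_add_left_eq_sub]
      linarith

theorem half_mem_cantorWithMidpoints : (1 / 2 : ℝ) ∈ cantorWithMidpoints :=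
  Or.inr half_mem_gapMidpoints

theorem sixth_mem_cantorWithMidpoints : (1 / 6 : ℝ) ∈ cantorWithMidpoints := by
  have := div_three_mem_gapMidpoints half_mem_gapMidpoints
  norm_num at this
  exact Or.inr (by norm_num; exact this)

theorem five_sixths_mem_cantorWithMidpoints : (5 / 6 : ℝ) ∈ cantorWithMidpoints := by
  have := two_add_div_three_mem_gapMidpoints half_mem_gapMidpoints
  norm_num at this
  exact Or.inr this

theorem cantorWithMidpoints_cases {x : ℝ} (hx : x ∈ cantorWithMidpoints) :
    x = 1 / 2 ∨ (0 ≤ x ∧ x ≤ 1 / 3) ∨ (2 / 3 ≤ x ∧ x ≤ 1) := by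
  rw [← trisect_cantorWithMidpoints] at hx
  rcases hx with rfl | ⟨y, hy, rfl⟩ | ⟨y, hy, rfl⟩
  · exact Or.inl rfl
  · have := cantorWithMidpoints_subset_Icc hy
    exact Or.inr (Or.inl ⟨by linarith [this.1], by linarith [this.2]⟩)
  · have := cantorWithMidpoints_subset_Icc hy
    exact Or.inr (Or.inr ⟨by linarith [this.1], by linarith [this.2]⟩)

theorem cantorSet_ninths {x : ℝ} (hx : x ∈ cantorSet) :
    x ≤ 1 / 9 ∨ (2 / 9 ≤ x ∧ x ≤ 1 / 3) ∨ (2 / 3 ≤ x ∧ x ≤ 7 / 9) ∨ 8 / 9 ≤ x := by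
  rcases cantorSet_thirds hx with ⟨h, h'⟩ | ⟨h, h'⟩ <;>
  rcases cantorSet_thirds h' with ⟨h1, -⟩ | ⟨h1, -⟩
  · left; linarith
  · right; left; constructor <;> linarith
  · right; right; left; constructor <;> linarith
  · right; right; right; linarith

/-- At every scale `r ≤ 1` there is a separated net all of whose points are at distance at least
`r / 12` from the Cantor set. -/
theorem exists_isSeparatedNet_far_from_cantorSet (n : ℕ) {r : ℝ} (hr1 : r ≤ 1)
    (hr : ((3 : ℝ) ^ n)⁻¹ / 6 < r) :
    ∃ A, IsSeparatedNet cantorWithMidpoints r A ∧ ∀ a ∈ A, ∀ x ∈ cantorSet, r / 12 ≤ dist a x := by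
  have hsixth : ∀ x ∈ cantorSet, 1 / 18 ≤ |1 / 6 - x| := fun x hx => by
    rw [le_abs]
    rcases cantorSet_ninths hx with h | h | h | h
    · left; linarith
    · right; linarith
    · right; linarith
    · right; linarith
  have hhalf : ∀ x ∈ cantorSet, 1 / 6 ≤ |1 / 2 - x| := fun x hx => by
    rw [le_abs]
    rcases cantorSet_thirds hx with h | h
    · left; linarith
    · right; linarith
  have hfive : ∀ x ∈ cantorSet, 1 / 18 ≤ |5 / 6 - x| := fun x hx => by
    rw [le_abs]
    rcases cantorSet_ninths hx with h | h | h | h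
    · left; linarith
    · left; linarith
    · left; linarith
    · right; linarith
  induction n generalizing r with
  | zero =>
    rw [pow_zero, inv_one] at hr
    -- For `1/6 < r ≤ 1` the net is explicit: `1/2` alone reaches everything if `r > 1/2`; the pair
    -- `1/6`, `5/6` still reaches `1/2` if `r > 1/3`; below that all three points are used.
    rcases lt_or_ge (1 / 2) r with h2 | h2
    · refine ⟨{1 / 2}, ⟨singleton_subset_iff.2 half_mem_cantorWithMidpoints,
        pairwise_singleton _ _, fun x hx => ⟨1 / 2, rfl, ?_⟩⟩, ?_⟩
      · have := cantorWithMidpoints_subset_Icc hx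
        rw [Real.dist_eq, abs_lt]
        constructor <;> linarith [this.1, this.2]
      · rintro _ rfl x hx
        rw [Real.dist_eq]
        linarith [hhalf x hx]
    rcases lt_or_ge (1 / 3) r with h3 | h3
    · refine ⟨{1 / 6, 5 / 6}, ⟨?_, ?_, ?_⟩, ?_⟩
      · rintro _ (rfl | rfl)
        · exact sixth_mem_cantorWithMidpoints
        · exact five_sixths_mem_cantorWithMidpoints
      · refine pairwise_pair.2 fun _ => ?_
        rw [Real.dist_eq, Real.dist_eq]
        norm_num
        linarith
      · intro x hx
        rcases cantorWithMidpoints_cases hx with rfl | h | h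
        · refine ⟨1 / 6, Or.inl rfl, ?_⟩
          rw [Real.dist_eq]
          norm_num
          linarith
        · refine ⟨1 / 6, Or.inl rfl, ?_⟩
          rw [Real.dist_eq, abs_lt]
          constructor <;> linarith
        · refine ⟨5 / 6, Or.inr rfl, ?_⟩
          rw [Real.dist_eq, abs_lt]
          constructor <;> linarith
      · rintro _ (rfl | rfl) x hx <;> rw [Real.dist_eq]
        · linarith [hsixth x hx]
        · linarith [hfive x hx]
    · refine ⟨{1 / 6, 1 / 2, 5 / 6}, ⟨?_, ?_, ?_⟩, ?_⟩
      · rintro _ (rfl | rfl | rfl)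
        · exact sixth_mem_cantorWithMidpoints
        · exact half_mem_cantorWithMidpoints
        · exact five_sixths_mem_cantorWithMidpoints
      · rintro _ (rfl | rfl | rfl) _ (rfl | rfl | rfl) hne <;>
        first
        | exact absurd rfl hne
        | (change r ≤ |_ - _|; norm_num [abs_of_pos, abs_of_neg]; linarith)
      · intro x hx
        rcases cantorWithMidpoints_cases hx with rfl | h | h
        · refine ⟨1 / 2, Or.inr (Or.inl rfl), ?_⟩
          rw [dist_self]
          linarith
        · refine ⟨1 / 6, Or.inl rfl, ?_⟩
          rw [Real.dist_eq, abs_lt]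
          constructor <;> linarith
        · refine ⟨5 / 6, Or.inr (Or.inr rfl), ?_⟩
          rw [Real.dist_eq, abs_lt]
          constructor <;> linarith
      · rintro _ (rfl | rfl | rfl) x hx <;> rw [Real.dist_eq]
        · linarith [hsixth x hx]
        · linarith [hhalf x hx]
        · linarith [hfive x hx]
  | succ n ih =>
    rcases lt_or_ge (((3 : ℝ) ^ n)⁻¹ / 6) r with hlt | hge
    · exact ih hr1 hlt
    have h3 : ((3 : ℝ) ^ n)⁻¹ = 3 * ((3 : ℝ) ^ (n + 1))⁻¹ := by
      rw [pow_succ]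
      field_simp
    have hn : ((3 : ℝ) ^ n)⁻¹ ≤ 1 := inv_le_one_of_one_le₀ (one_le_pow₀ (by norm_num))
    -- Now `3 * r ≤ 1/2`, so the net at scale `3 * r` may be trisected. Distances within a third
    -- shrink exactly by `3`; distances between the outer thirds are at least `1/3`.
    obtain ⟨A, hA, hfar⟩ := ih (r := 3 * r) (by linarith) (by linarith)
    refine ⟨trisect A, ?_, ?_⟩
    · have := hA.trisect (by linarith)
      rwa [mul_div_cancel_left₀ r three_ne_zero] at this
    rintro _ (rfl | ⟨a, ha, rfl⟩ | ⟨a, ha, rfl⟩) x hx <;> rw [Real.dist_eq]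
    · linarith [hhalf x hx]
    · have haI := cantorWithMidpoints_subset_Icc (hA.1 ha)
      rcases cantorSet_thirds hx with ⟨h, h'⟩ | ⟨h, h'⟩
      · have := hfar a ha _ h'
        have e : |a - 3 * x| = 3 * |a / 3 - x| := by
          rw [← abs_of_pos (by norm_num : (0 : ℝ) < 3), ← abs_mul,
            abs_of_pos (by norm_num : (0 : ℝ) < 3)]
          congr 1
          ring
        rw [Real.dist_eq, e] at this
        dsimp only
        linarith
      · refine le_trans ?_ (neg_le_abs _)
        linarith [haI.2]
    · have haI := cantorWithMidpoints_subset_Icc (hA.1 ha)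
      rcases cantorSet_thirds hx with ⟨h, h'⟩ | ⟨h, h'⟩
      · refine le_trans ?_ (le_abs_self _)
        linarith [haI.1]
      · have := hfar a ha _ h'
        have e : |a - (3 * x - 2)| = 3 * |(2 + a) / 3 - x| := by
          rw [← abs_of_pos (by norm_num : (0 : ℝ) < 3), ← abs_mul,
            abs_of_pos (by norm_num : (0 : ℝ) < 3)]
          congr 1
          ring
        rw [Real.dist_eq, e] at this
        dsimp only
        linarith

theorem exists_isSeparatedNet_one_div {q : ℕ} (hq : 1 ≤ q) :
    ∃ A, IsSeparatedNet cantorWithMidpoints (1 / (q : ℝ)) A ∧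
      ∀ a ∈ A, ∀ x ∈ cantorSet, 1 / (q : ℝ) / 12 ≤ dist a x := by
  have hq0 : (0 : ℝ) < q := Nat.cast_pos.2 hq
  obtain ⟨n, hn⟩ := exists_pow_lt_of_lt_one (one_div_pos.2 hq0) (by norm_num : (3 : ℝ)⁻¹ < 1)
  rw [inv_pow] at hn
  refine exists_isSeparatedNet_far_from_cantorSet n ?_ ?_
  · exact (div_le_one hq0).2 (Nat.one_le_cast.2 hq)
  · have : 0 < ((3 : ℝ) ^ n)⁻¹ := by positivity
    linarith

end SeparatedNets

/-! ### Abstract rationals with countable approximable sets. -/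

section GoodRationals

theorem exists_countable_approximableSet :
    ∃ P : ℕ → Set ℝ, IsAbstractRationals cantorWithMidpoints P ∧
      ∀ t : ℝ, 1 < t → (approximableSet cantorWithMidpoints P t).Countable := by
  have hex : ∀ q : ℕ, ∃ A, 1 ≤ q → IsSeparatedNet cantorWithMidpoints (1 / (q : ℝ)) A ∧
      ∀ a ∈ A, ∀ x ∈ cantorSet, 1 / (q : ℝ) / 12 ≤ dist a x := fun q => by
    by_cases hq : 1 ≤ q
    · obtain ⟨A, hA⟩ := exists_isSeparatedNet_one_div hq
      exact ⟨A, fun _ => hA⟩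
    · exact ⟨∅, fun h => absurd h hq⟩
  choose P hP using hex
  refine ⟨P, fun q hq => (hP q hq).1.maximal, fun t ht => ?_⟩
  refine countable_gapMidpoints_cantorSet.mono ?_
  rintro x ⟨hxF, hx⟩
  refine hxF.resolve_left fun hxC => ?_
  have hlim : Tendsto (fun q : ℕ => (q : ℝ) ^ (t - 1)) atTop atTop :=
    (tendsto_rpow_atTop (by linarith)).comp tendsto_natCast_atTop_atTop
  -- Once `q ^ (t - 1) > 12`, the radius `q ^ (-t)` is below the distance `1 / (12 q)` from the net
  -- to the Cantor set.
  obtain ⟨N, hN⟩ := eventually_atTop.1 (hlim.eventually_gt_atTop 12)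
  obtain ⟨q, hq, p, hp, hpx⟩ := hx N
  have hq1 : 1 ≤ q := by omega
  have hq0 : (0 : ℝ) < q := Nat.cast_pos.2 hq1
  have h1 := ((hP q hq1).2 p hp x hxC).trans hpx
  have h2 := hN q hq.le
  rw [Real.rpow_sub_one hq0.ne', lt_div_iff₀ hq0] at h2
  rw [div_div] at h1
  exact absurd h1 (not_le.2 (one_div_lt_one_div_of_lt (by positivity) (by linarith)))

end GoodRationals

/-! ### Abstract rationals with approximable sets of positive dimension. -/

section BadRationals

/-- The separated nets at scale `1 / (2 * 3 ^ n)` containing all left endpoints of the intervals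
of length `1 / 3 ^ (n + 1)` in the construction of the Cantor set. -/
def endpointNet : ℕ → Set ℝ
  | 0 => {0, 2 / 3}
  | n + 1 => trisect (endpointNet n)

theorem isSeparatedNet_endpointNet (n : ℕ) :
    IsSeparatedNet cantorWithMidpoints (1 / (2 * 3 ^ n)) (endpointNet n) := by
  induction n with
  | zero =>
    refine ⟨?_, ?_, ?_⟩
    · rintro _ (rfl | rfl)
      · exact Or.inl zero_mem_cantorSet
      · exact Or.inl two_thirds_mem_cantorSet
    · refine pairwise_pair.2 fun _ => ?_
      rw [Real.dist_eq, Real.dist_eq]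
      norm_num [abs_of_pos]
    · intro x hx
      rcases cantorWithMidpoints_cases hx with rfl | h | h
      · refine ⟨2 / 3, Or.inr rfl, ?_⟩
        rw [Real.dist_eq, abs_lt]
        constructor <;> norm_num
      · refine ⟨0, Or.inl rfl, ?_⟩
        rw [Real.dist_eq, abs_lt]
        constructor <;> norm_num <;> linarith
      · refine ⟨2 / 3, Or.inr rfl, ?_⟩
        rw [Real.dist_eq, abs_lt]
        constructor <;> norm_num <;> linarith
  | succ n ih =>
    have h1 : (1 : ℝ) ≤ 3 ^ n := one_le_pow₀ (by norm_num)
    have := ih.trisect (one_div_le_one_div_of_le two_pos (by linarith))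
    rw [div_div, mul_assoc, ← pow_succ] at this
    exact this

theorem cantorPoint_eq_shift (b : ℕ → Bool) :
    cantorPoint b = (cond (b 0) 2 0 + cantorPoint fun i => b (i + 1)) / 3 := by
  unfold cantorPoint
  rw [Real.ofDigits_eq_sum_add_ofDigits _ 1, Finset.sum_range_one, Real.ofDigitsTerm]
  cases b 0
  · simp
    ring
  · simp
    ring

theorem cantorPoint_of_forall_eq_false {b : ℕ → Bool} (h : ∀ i, b i = false) :
    cantorPoint b = 0 := by
  simp [cantorPoint, Real.ofDigits, Real.ofDigitsTerm, h]

theorem cantorPoint_mem_endpointNet {n : ℕ} {b : ℕ → Bool} (h : ∀ i, n < i → b i = false) :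
    cantorPoint b ∈ endpointNet n := by
  induction n generalizing b with
  | zero =>
    rw [cantorPoint_eq_shift, cantorPoint_of_forall_eq_false (fun i => h (i + 1) i.succ_pos)]
    cases b 0
    · left
      simp
    · right
      simp
  | succ n ih =>
    have := ih (b := fun i => b (i + 1)) fun i hi => h (i + 1) (by omega)
    rw [cantorPoint_eq_shift]
    cases b 0
    · rw [cond_false, zero_add]
      exact div_three_mem_trisect this
    · exact two_add_div_three_mem_trisect this

/-- Cutting the expansion off after digit `n` changes none of the first `m` digits. -/
theorem exists_mem_endpointNet_dist_le {n m : ℕ} {b : ℕ → Bool}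
    (h : ∀ i, n < i → i < m → b i = false) :
    ∃ p ∈ endpointNet n, dist p (cantorPoint b) ≤ ((3 : ℝ) ^ m)⁻¹ := by
  refine ⟨cantorPoint fun i => b i && decide (i ≤ n), cantorPoint_mem_endpointNet fun i hi => ?_,
    ?_⟩
  · simp [hi]
  · rw [Real.dist_eq]
    have := Real.abs_ofDigits_sub_ofDigits_le (b := 3) (n := m)
      (x := fun i => cond (b i && decide (i ≤ n)) (2 : Fin 3) 0)
      (y := fun i => cond (b i) (2 : Fin 3) 0) (fun i hi => by
        by_cases hin : i ≤ n
        · simp [hin]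
        · simp [h i (not_le.1 hin) hi])
    exact_mod_cast this

/-- Positions of the free digits: they avoid `[L ^ (k + 2), T * L ^ (k + 2))`, `L = T + 1`,
for every `k`. -/
def freePosition (T j : ℕ) : ℕ := j + T * (T + 1) ^ (Nat.log (T + 1) j + 1)

theorem strictMono_freePosition (T : ℕ) : StrictMono (freePosition T) := by
  intro i j hij
  have h := Nat.log_mono_right (b := T + 1) hij.le
  have h' : (T + 1) ^ (Nat.log (T + 1) i + 1) ≤ (T + 1) ^ (Nat.log (T + 1) j + 1) :=
    Nat.pow_le_pow_right T.succ_pos (by omega)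
  exact Nat.add_lt_add_of_lt_of_le hij (Nat.mul_le_mul_left T h')

theorem freePosition_add_one_le (T j : ℕ) :
    freePosition T j + 1 ≤ (1 + T * (T + 1)) * (j + 1) := by
  have h : (T + 1) ^ Nat.log (T + 1) j ≤ j + 1 := Nat.pow_log_le_add_one _ _
  calc freePosition T j + 1 = (j + 1) + T * (T + 1) * (T + 1) ^ Nat.log (T + 1) j := by
        rw [freePosition, pow_succ]; ring
    _ ≤ (j + 1) + T * (T + 1) * (j + 1) := by gcongr
    _ = (1 + T * (T + 1)) * (j + 1) := by ring

/-- With `L = T + 1` and `l = Nat.log L j`, the bound `j < L ^ (l + 1)` puts the position in `[T * L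
^ (l + 1), L ^ (l + 2))`. It is past the gap if `l > k` and before it if `l ≤ k`. -/
theorem freePosition_notMem_gap {T : ℕ} (hT : 0 < T) (k j : ℕ)
    (h : (T + 1) ^ (k + 2) ≤ freePosition T j) : T * (T + 1) ^ (k + 2) ≤ freePosition T j := by
  rcases Nat.lt_or_ge k (Nat.log (T + 1) j) with hk | hk
  · refine le_trans (Nat.mul_le_mul_left T (Nat.pow_le_pow_right T.succ_pos ?_))
      (Nat.le_add_left _ _)
    omega
  · exfalso
    have h1 : j < (T + 1) ^ (k + 1) := Nat.lt_pow_of_log_lt (by omega) (by omega)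
    have h2 : (T + 1) ^ (Nat.log (T + 1) j + 1) ≤ (T + 1) ^ (k + 1) :=
      Nat.pow_le_pow_right T.succ_pos (by omega)
    have h3 := Nat.mul_le_mul_left T h2
    have h4 : (T + 1) ^ (k + 2) = (T + 1) ^ (k + 1) + T * (T + 1) ^ (k + 1) := by
      rw [pow_succ _ (k + 1)]; ring
    unfold freePosition at h
    omega

theorem inv_pow_le_one_div_rpow {n T : ℕ} {t : ℝ} (ht : 0 ≤ t) (htT : t ≤ T) :
    ((3 : ℝ) ^ (T * (n + 1)))⁻¹ ≤ 1 / ((2 * 3 ^ n : ℕ) : ℝ) ^ t := by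
  rw [one_div]
  have h1 : (1 : ℝ) ≤ 3 ^ (n + 1) := one_le_pow₀ (by norm_num)
  have h0 : (0 : ℝ) < (2 * 3 ^ n : ℕ) := by positivity
  refine inv_anti₀ (Real.rpow_pos_of_pos h0 t) ?_
  calc ((2 * 3 ^ n : ℕ) : ℝ) ^ t ≤ ((3 : ℝ) ^ (n + 1)) ^ t := by
        refine Real.rpow_le_rpow h0.le ?_ ht
        push_cast
        rw [pow_succ]
        linarith [pow_pos (three_pos (α := ℝ)) n]
    _ ≤ ((3 : ℝ) ^ (n + 1)) ^ (T : ℝ) := Real.rpow_le_rpow_of_exponent_le h1 htT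
    _ = (3 : ℝ) ^ (T * (n + 1)) := by rw [Real.rpow_natCast, ← pow_mul, mul_comm]

theorem exists_dimH_approximableSet_pos :
    ∃ P : ℕ → Set ℝ, IsAbstractRationals cantorWithMidpoints P ∧
      ∀ t : ℝ, 1 < t → 0 < dimH (approximableSet cantorWithMidpoints P t) := by
  -- Only the levels `2 * 3 ^ n` matter; any net serves elsewhere. The choice does not depend on
  -- `t`.
  have hex : ∀ q : ℕ, ∃ A, 1 ≤ q → IsSeparatedNet cantorWithMidpoints (1 / (q : ℝ)) A ∧
      ∀ n, q = 2 * 3 ^ n → A = endpointNet n := fun q => by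
    by_cases hq : 1 ≤ q
    · by_cases hn : ∃ n, q = 2 * 3 ^ n
      · obtain ⟨n, rfl⟩ := hn
        refine ⟨endpointNet n, fun _ => ⟨?_, fun m hm => ?_⟩⟩
        · have := isSeparatedNet_endpointNet n
          push_cast
          exact this
        · rw [Nat.pow_right_injective (by norm_num : 2 ≤ 3)
            (Nat.eq_of_mul_eq_mul_left two_pos hm)]
      · obtain ⟨A, hA, -⟩ := exists_isSeparatedNet_one_div hq
        exact ⟨A, fun _ => ⟨hA, fun n hq' => absurd ⟨n, hq'⟩ hn⟩⟩
    · exact ⟨∅, fun h => absurd h hq⟩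
  choose P hP using hex
  refine ⟨P, fun q hq => (hP q hq).1.maximal, fun t ht => ?_⟩
  obtain ⟨T, hT⟩ := exists_nat_ge t
  have hT0 : 0 < T := (Nat.cast_pos (α := ℝ)).1 (by linarith)
  have hdim := le_dimH_range_cantorPoint_spreadDigits (strictMono_freePosition T)
    (Nat.add_pos_left one_pos _) (freePosition_add_one_le T)
  refine lt_of_lt_of_le ?_ (hdim.trans (dimH_mono ?_))
  · rw [ENNReal.ofReal_pos]
    have := Real.log_pos one_lt_two
    have := Real.log_pos (by norm_num : (1 : ℝ) < 3)
    positivity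
  rintro _ ⟨c, rfl⟩
  refine ⟨Or.inl (cantorPoint_mem_cantorSet _), fun N => ?_⟩
  have hL : N + 2 < (T + 1) ^ (N + 2) := Nat.lt_pow_self (by omega)
  -- The zero block `[n + 1, T * (n + 1))` is then the gap with index `k = N`, and the level `2 * 3
  -- ^ n` exceeds `N`.
  obtain ⟨n, hn⟩ : ∃ n, (T + 1) ^ (N + 2) = n + 1 := ⟨(T + 1) ^ (N + 2) - 1, by omega⟩
  have hq : 1 ≤ 2 * 3 ^ n := Nat.mul_pos two_pos (pow_pos three_pos n)
  have hn3 : n < 3 ^ n := Nat.lt_pow_self (by norm_num)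
  obtain ⟨p, hp, hpx⟩ := exists_mem_endpointNet_dist_le (n := n) (m := T * (n + 1))
    (b := spreadDigits (freePosition T) c) (fun i hi him => by
      rw [Bool.eq_false_iff, Ne, spreadDigits_eq_true_iff]
      rintro ⟨j, rfl, -⟩
      have := freePosition_notMem_gap hT0 N j (by omega)
      rw [hn] at this
      omega)
  refine ⟨2 * 3 ^ n, by omega, p, ?_, ?_⟩
  · rwa [(hP _ hq).2 n rfl]
  · exact hpx.trans (inv_pow_le_one_div_rpow (by linarith) hT)

end BadRationals

theorem mainTheorem7 :
    ∃ F : Set ℝ, F = cantorSet ∪ gapMidpoints cantorSet ∧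
      IsCompact F ∧ F ⊆ Set.Icc 0 1 ∧
      dimH F = packingDim F ∧ 0 < dimH F ∧
      (∃ P : ℕ → Set ℝ, IsAbstractRationals F P ∧
        ∀ t : ℝ, 1 < t → (approximableSet F P t).Countable) ∧
      (∃ P : ℕ → Set ℝ, IsAbstractRationals F P ∧
        ∀ t : ℝ, 1 < t → 0 < dimH (approximableSet F P t)) := by
  refine ⟨cantorWithMidpoints, rfl, isCompact_cantorWithMidpoints, cantorWithMidpoints_subset_Icc,
    dimH_cantorSet_union_eq_packingDim countable_gapMidpoints_cantorSet, ?_,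
    exists_countable_approximableSet, exists_dimH_approximableSet_pos⟩
  refine lt_of_lt_of_le ?_ (le_dimH_cantorSet.trans (dimH_mono subset_union_left))
  rw [ENNReal.ofReal_pos]
  exact div_pos (Real.log_pos one_lt_two) (Real.log_pos (by norm_num))
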